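/- Let $K\ge 1$ and let $q_0,q_1:\mathbb R^K\to[0,\infty)$ be probability densities with respect to Lebesgue measure $\ell$; let $Q_0,Q_1$ be the corresponding laws, so that a test statistic $\mathbf X=(X_1,\dots,X_K)$ has law $Q_0$ under true nulls and $Q_1$ under false nulls. Write $\mathrm{sppt}(q)=\{\mathbf x: q(\mathbf x)>0\}$. For $1\le k\le K$ let $$f_k(x_1,\dots,x_k)=\int_{\mathbb R^{K-k}}q_0(x_1,\dots,x_k,u_{k+1},\dots,u_K)\,du_{k+1}\cdots du_K$$ be the marginal density of $(X_1,\dots,X_k)$ under $Q_0$ (so $f_K=q_0$), and put $f_0=1$. Define $\phi=(\phi_1,\dots,\phi_K)$ by the conditional distribution functions under $Q_0$, $$\phi_k(\mathbf x)=Q_0(X_k\le x_k\mid X_s=x_s,\ s<k)=\int_{-\infty}^{x_k}\frac{f_k(x_1,\dots,x_{k-1},z)}{f_{k-1}(x_1,\dots,x_{k-1})}\,dz ,$$ so that $\phi_1(\mathbf x)=Q_0(X_1\le x_1)$; where $f_{k-1}=0$ the value of $\phi_k$ is immaterial. Let $\xi=\phi(\mathbf X)$. Suppose that (i) $\mathrm{sppt}(q_1)\subset\mathrm{sppt}(q_0)$;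 (ii) every $f_k$, $1\le k\le K$, is finite everywhere and continuous; (iii) $q_1$ is continuous on $\mathrm{sppt}(q_0)$. Then: 1. $\phi$ maps $\mathrm{sppt}(q_0)$ into $[0,1]^K$ and is continuous and injective on $\mathrm{sppt}(q_0)$. 2. If $\mathbf X\sim Q_0$, then $\xi_1,\dots,\xi_K$ are i.i.d. $\mathrm{Unif}(0,1)$. 3. The set $E:=\phi(\mathrm{sppt}(q_0))$ is open in $\mathbb R^K$ and $\ell([0,1]^K\setminus E)=0$. With $\phi^{-1}:E\to\mathrm{sppt}(q_0)$ the inverse of $\phi$ on $\mathrm{sppt}(q_0)$, the function $g(\mathbf u)=q_1(\phi^{-1}(\mathbf u))/q_0(\phi^{-1}(\mathbf u))$ is continuous on $E$, and if $\mathbf X\sim Q_1$, then $\xi$ has density $g$ on $E$, that is, $P(\xi\in A)=\int_{A\cap E}g\,d\ell$ for every Borel set $A\subset\mathbb R^K$. -/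

import Mathlib

open MeasureTheory ProbabilityTheory Set
open scoped ENNReal NNReal

noncomputable section

namespace MultPValue

variable {K : ℕ}

/-- The set where a density is positive (no closure is taken). -/
def sppt (q : (Fin K → ℝ) → ℝ≥0) : Set (Fin K → ℝ) := {x | 0 < q x}

/-- The law on `ℝ^K` with Lebesgue density `q`. -/
def law (q : (Fin K → ℝ) → ℝ≥0) : Measure (Fin K → ℝ) :=
  volume.withDensity fun x => (q x : ℝ≥0∞)

/-- The marginal density of the first `k` coordinates under the density `q`:
the coordinates with (zero-based) index at least `k` are integrated out. It is written as a
function on `ℝ^K` that depends on its argument only through the first `k` coordinates.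
For `k = K` it is `q` and for `k = 0` it is the constant `∫ q`. -/
def marginalDensity (q : (Fin K → ℝ) → ℝ≥0) (k : ℕ) (x : Fin K → ℝ) : ℝ≥0∞ :=
  lmarginal (fun _ => volume) (Finset.univ.filter fun j : Fin K => k ≤ (j : ℕ))
    (fun y => (q y : ℝ≥0∞)) x

/-- The conditional density at `z` of the coordinate `X_j` given `X_s = x_s` for all `s < j`.
Indices are zero-based, so that `marginalDensity q j` is the joint density of the coordinates
before `X_j`. For the first coordinate the denominator is the total mass `∫ q = 1`, and this is
the marginal density of the first coordinate. -/
def condDensity (q : (Fin K → ℝ) → ℝ≥0) (j : Fin K) (x : Fin K → ℝ) (z : ℝ) : ℝ≥0∞ :=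
  marginalDensity q ((j : ℕ) + 1) (Function.update x j z) / marginalDensity q (j : ℕ) x

/-- The conditional law of `X_j` given `X_s = x_s` for all `s < j`. -/
def condLaw (q : (Fin K → ℝ) → ℝ≥0) (j : Fin K) (x : Fin K → ℝ) : Measure ℝ :=
  volume.withDensity (condDensity q j x)

/-- The multivariate p-value: `φ_j(x)` is the conditional probability of `X_j ≤ x_j` given
`X_s = x_s` for all `s < j` (for the first coordinate, the probability of `X_j ≤ x_j`). -/
def phi (q : (Fin K → ℝ) → ℝ≥0) (x : Fin K → ℝ) : Fin K → ℝ :=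
  fun j => (condLaw q j x).real (Iic (x j))

/-- The range `E = φ(sppt q₀)`. -/
def pRange (q₀ : (Fin K → ℝ) → ℝ≥0) : Set (Fin K → ℝ) := phi q₀ '' sppt q₀

/-- The inverse of `φ : sppt q₀ → E`; its values off `E` carry no meaning. -/
def phiInv (q₀ : (Fin K → ℝ) → ℝ≥0) : (Fin K → ℝ) → (Fin K → ℝ) :=
  Function.invFunOn (phi q₀) (sppt q₀)

/-- The density `g = (q₁ ∘ φ⁻¹) / (q₀ ∘ φ⁻¹)`, to be used on `E` only. -/
def likelihoodRatio (q₀ q₁ : (Fin K → ℝ) → ℝ≥0) (u : Fin K → ℝ) : ℝ≥0 :=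
  q₁ (phiInv q₀ u) / q₀ (phiInv q₀ u)

end MultPValue

end

section

open Filter Topology Function

namespace MultPValue

/-! The map φ is triangular: φ_j depends only on x_i with i ≤ j and, for fixed earlier coordinates,
is a conditional distribution function of x_j, strictly increasing through points where the next
marginal is positive (`phi_lt`). Recovering the coordinates one by one gives injectivity. The
numerator of φ_j is continuous because it and the complementary tail are lower semicontinuous by
Fatou and add up to a finite continuous marginal (`continuous_lintegral_Iic`).

Replacing coordinates by p-values from the last to the first factors φ into maps that each alter one
coordinate (`partialPhi_eq_update`). Each factor is open on the relevant sets by the intermediate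
value theorem (`isOpen_image_update`), and makes one more coordinate uniform and independent of the
others by Tonelli and the probability integral transform (`map_update_phi`). So φ is open on the
support of q₀, its inverse is continuous, and it sends Q₀ to Lebesgue measure on the unit cube.
Under Q₁ no Jacobian is needed: q₁ = q₀ · (g ∘ φ) pointwise, so the image of Q₁ is g times the image
of Q₀. -/

/-! ### Continuity of partial integrals, open maps, probability integral transform -/

theorem lowerSemicontinuous_lintegral {X α : Type*} [TopologicalSpace X]
    [FirstCountableTopology X] [MeasurableSpace α] {μ : Measure α} {G : X → α → ℝ≥0∞}
    (hm : ∀ x, Measurable (G x)) (hG : ∀ z, LowerSemicontinuous fun x => G x z) :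
    LowerSemicontinuous fun x => ∫⁻ z, G x z ∂μ := by
  intro x
  refine lowerSemicontinuousAt_iff_le_liminf.2 ?_
  refine le_trans (lintegral_mono fun z => ?_) (lintegral_liminf_le hm)
  exact lowerSemicontinuousAt_iff_le_liminf.1 (hG z x)

/-- Morally f = (f + g) - g is continuous minus lower semicontinuous, hence upper semicontinuous;
finiteness makes the cancellation legitimate. -/
theorem continuous_of_lowerSemicontinuous_add {X : Type*} [TopologicalSpace X]
    {f g : X → ℝ≥0∞} (hf : LowerSemicontinuous f) (hg : LowerSemicontinuous g)
    (h : Continuous fun x => f x + g x) (hfin : ∀ x, f x + g x ≠ ∞) : Continuous f := by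
  rw [continuous_iff_lower_upperSemicontinuous]
  refine ⟨hf, fun x c hc => ?_⟩
  have hgx : g x ≠ ∞ := fun h => hfin x (by simp [h])
  obtain ⟨d, hd, hdc⟩ := exists_between hc
  have hd_top : d ≠ ∞ := ne_top_of_lt hdc
  have hlt : f x + g x < d + g x := ENNReal.add_lt_add_right hgx hd
  rcases eq_or_ne (g x) 0 with h0 | h0
  -- Nothing lies below g x = 0, but here the sum alone bounds f.
  · have : ∀ᶠ y in 𝓝 x, f y + g y < c := by
      refine h.continuousAt.eventually_lt continuousAt_const ?_
      simpa [h0] using hc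
    filter_upwards [this] with y hy using lt_of_le_of_lt le_self_add hy
  -- With e this close to g x, the bounds f y + g y < c + e and e < g y force f y < c.
  · obtain ⟨e, he, hec⟩ : ∃ e < g x, d + g x < c + e := by
      obtain ⟨e, he1, he2⟩ : ∃ e, g x - (c - d) < e ∧ e < g x := by
        apply exists_between
        exact ENNReal.sub_lt_self hgx h0 (tsub_pos_of_lt hdc).ne'
      refine ⟨e, he2, ?_⟩
      have h1 : g x < e + (c - d) := by
        rcases eq_or_ne (c - d) ∞ with ht | ht
        · rw [ht]; simpa using hgx.lt_top
        · by_contra! hge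
          exact absurd he1 (not_lt.2 (ENNReal.le_sub_of_add_le_right ht hge))
      calc d + g x < d + (e + (c - d)) := ENNReal.add_lt_add_left hd_top h1
        _ = (d + (c - d)) + e := by ring
        _ = c + e := by rw [add_tsub_cancel_of_le hdc.le]
    have h1 : ∀ᶠ y in 𝓝 x, f y + g y < d + g x :=
      h.continuousAt.eventually_lt continuousAt_const hlt
    filter_upwards [h1, hg x e he] with y hy1 hy2
    by_contra! hcy
    exact absurd (hy1.trans hec) (not_lt.2 (add_le_add hcy hy2.le))

theorem lowerSemicontinuous_indicator_of_continuous {X : Type*} [TopologicalSpace X] {s : Set X}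
    (hs : IsOpen s) {f : X → ℝ≥0∞} (hf : Continuous f) :
    LowerSemicontinuous (s.indicator f) := by
  intro x c hc
  by_cases hx : x ∈ s
  · rw [indicator_of_mem hx] at hc
    filter_upwards [hs.mem_nhds hx, continuousAt_const.eventually_lt hf.continuousAt hc] with y hy h
    rwa [indicator_of_mem hy]
  · simp [indicator_of_notMem hx] at hc

/-- Integrating a nonnegative continuous function in one variable up to that variable is a
continuous operation as soon as the full integral is continuous and finite. -/
theorem continuous_lintegral_Iic {ι : Type*} [Finite ι] [DecidableEq ι] (j : ι)
    {f : (ι → ℝ) → ℝ≥0∞} (hf : Continuous f)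
    (hF : Continuous fun x => ∫⁻ z, f (update x j z)) (hfin : ∀ x, ∫⁻ z, f (update x j z) ≠ ∞) :
    Continuous fun x : ι → ℝ => ∫⁻ z in Iic (x j), f (update x j z) := by
  have hup : ∀ x : ι → ℝ, Continuous fun z => f (update x j z) := fun x => by fun_prop
  have hadd : ∀ x : ι → ℝ, (∫⁻ z in Iic (x j), f (update x j z)) +
      ∫⁻ z in Ioi (x j), f (update x j z) = ∫⁻ z, f (update x j z) := fun x => by
    rw [← compl_Iic]; exact lintegral_add_compl _ measurableSet_Iic
  refine continuous_of_lowerSemicontinuous_add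
    (g := fun x => ∫⁻ z in Ioi (x j), f (update x j z)) ?_ ?_ ?_ ?_
  -- Dropping the null endpoint makes {x | z < x j} open, so its indicator is lower semicontinuous.
  · simp_rw [← setLIntegral_congr Iio_ae_eq_Iic, ← lintegral_indicator measurableSet_Iio]
    refine lowerSemicontinuous_lintegral
      (fun x => (hup x).measurable.indicator measurableSet_Iio) fun z => ?_
    exact lowerSemicontinuous_indicator_of_continuous (s := {x : ι → ℝ | z < x j})
      (isOpen_lt (by fun_prop) (by fun_prop)) (f := fun x => f (update x j z)) (by fun_prop)
  · simp_rw [← lintegral_indicator measurableSet_Ioi]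
    refine lowerSemicontinuous_lintegral
      (fun x => (hup x).measurable.indicator measurableSet_Ioi) fun z => ?_
    exact lowerSemicontinuous_indicator_of_continuous (s := {x : ι → ℝ | x j < z})
      (isOpen_lt (by fun_prop) (by fun_prop)) (f := fun x => f (update x j z)) (by fun_prop)
  · simpa only [hadd] using hF
  · simpa only [hadd] using hfin

/-- Replacing one coordinate by a continuous function that is strictly increasing in that
coordinate is an open map. -/
theorem isOpen_image_update {ι : Type*} [DecidableEq ι] (j : ι) {ψ : (ι → ℝ) → ℝ}
    {W : Set (ι → ℝ)} (hW : IsOpen W) (hψ : ContinuousOn ψ W)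
    (hmono : ∀ x a b, a < b → (∀ z ∈ Icc a b, update x j z ∈ W) →
      ψ (update x j a) < ψ (update x j b)) :
    IsOpen ((fun x => update x j (ψ x)) '' W) := by
  rw [isOpen_iff_mem_nhds]
  rintro _ ⟨x, hx, rfl⟩
  have hcx : Continuous fun z : ℝ => update x j z := by fun_prop
  have hpre : (fun z : ℝ => update x j z) ⁻¹' W ∈ 𝓝 (x j) :=
    (hW.preimage hcx).mem_nhds (by simpa using hx)
  obtain ⟨ε, hε, hball⟩ := Metric.nhds_basis_closedBall.mem_iff.1 hpre
  rw [Real.closedBall_eq_Icc] at hball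
  set a := x j - ε
  set b := x j + ε
  have ha : a < x j := by simp [a, hε]
  have hb : x j < b := by simp [b, hε]
  have hab : a < b := ha.trans hb
  have h1 : ψ (update x j a) < ψ x := by
    simpa using hmono x a (x j) ha fun z hz => hball ⟨hz.1, hz.2.trans hb.le⟩
  have h2 : ψ x < ψ (update x j b) := by
    simpa using hmono x (x j) b hb fun z hz => hball ⟨ha.le.trans hz.1, hz.2⟩
  -- The point y₀ may lie outside W, but it differs from x only at j, so its updates at j are those
  -- of x.
  set y₀ := update x j (ψ x) with hy₀
  have hcont : ∀ c ∈ Icc a b, ContinuousAt (fun y : ι → ℝ => ψ (update y j c)) y₀ := fun c hc => by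
    have hmem : update y₀ j c ∈ W := by simpa [hy₀] using hball hc
    exact ContinuousAt.comp (f := fun y : ι → ℝ => update y j c)
      (hψ.continuousAt (hW.mem_nhds hmem)) (by fun_prop : Continuous _).continuousAt
  have e1 : ∀ᶠ y in 𝓝 y₀, ψ (update y j a) < y j :=
    (hcont a (left_mem_Icc.2 hab.le)).eventually_lt (continuous_apply j).continuousAt
      (by simpa [hy₀] using h1)
  have e2 : ∀ᶠ y in 𝓝 y₀, y j < ψ (update y j b) :=
    (continuous_apply j).continuousAt.eventually_lt (hcont b (right_mem_Icc.2 hab.le))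
      (by simpa [hy₀] using h2)
  have e3 : ∀ᶠ y in 𝓝 y₀, ∀ z ∈ Icc a b, update y j z ∈ W := by
    refine isCompact_Icc.eventually_forall_of_forall_eventually fun z hz => ?_
    have hc : Continuous fun p : (ι → ℝ) × ℝ => update p.1 j p.2 := by fun_prop
    exact (hW.preimage hc).mem_nhds (by simpa [hy₀] using hball hz)
  filter_upwards [e1, e2, e3] with y h1 h2 h3
  have hc : ContinuousOn (fun z => ψ (update y j z)) (Icc a b) :=
    hψ.comp (by fun_prop : Continuous fun z => update y j z).continuousOn h3
  obtain ⟨z, hz, hzy⟩ := intermediate_value_Icc hab.le hc ⟨h1.le, h2.le⟩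
  refine ⟨update y j z, h3 z hz, ?_⟩
  simp only [] at hzy
  simp [hzy]

/-- The probability integral transform. -/
theorem map_cdf_eq_uniform (μ : Measure ℝ) [IsProbabilityMeasure μ] [NullSingletonClass μ] :
    μ.map (fun z => μ.real (Iic z)) = volume.restrict (Ioo (0 : ℝ) 1) := by
  have hF : (fun z => μ.real (Iic z)) = cdf μ := funext fun z => (cdf_eq_real μ z).symm
  rw [hF]
  have hmeas : Measurable (cdf μ) := (monotone_cdf μ).measurable
  have hcont : Continuous (cdf μ) := by
    rw [continuous_iff_continuousAt]
    intro x
    have h := StieltjesFunction.measure_singleton (cdf μ) x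
    -- The mass of a singleton is the jump of the distribution function, so no atoms means no jumps.
    rw [measure_cdf, measure_singleton] at h
    rw [(monotone_cdf μ).continuousAt_iff_leftLim_eq_rightLim]
    refine le_antisymm ((monotone_cdf μ).leftLim_le_rightLim le_rfl) ?_
    rw [StieltjesFunction.rightLim_eq]
    have := ENNReal.ofReal_eq_zero.1 h.symm
    linarith
  have : IsProbabilityMeasure (μ.map (cdf μ)) := Measure.isProbabilityMeasure_map hmeas.aemeasurable
  refine Measure.ext_of_Iic _ _ fun u => ?_
  rw [Measure.map_apply hmeas measurableSet_Iic, Measure.restrict_apply measurableSet_Iic]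
  rcases lt_or_ge u 1 with hu1 | hu1
  · have hE : Iic u ∩ Ioo (0 : ℝ) 1 = Ioc 0 u := by
      ext x; constructor
      · exact fun hx => ⟨hx.2.1, hx.1⟩
      · exact fun hx => ⟨hx.2, hx.1, hx.2.trans_lt hu1⟩
    rw [hE, Real.volume_Ioc, sub_zero]
    rcases (cdf μ ⁻¹' Iic u).eq_empty_or_nonempty with hS | hS
    · rw [hS, measure_empty, eq_comm, ENNReal.ofReal_eq_zero]
      by_contra! hu
      obtain ⟨z, hz⟩ := ((tendsto_cdf_atBot μ).eventually (gt_mem_nhds hu)).exists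
      exact (hS ▸ (show z ∈ cdf μ ⁻¹' Iic u from hz.le) : z ∈ (∅ : Set ℝ))
    · obtain ⟨b, hb⟩ := ((tendsto_cdf_atTop μ).eventually (lt_mem_nhds hu1)).exists
      have hbdd : BddAbove (cdf μ ⁻¹' Iic u) := by
        refine ⟨b, fun z hz => ?_⟩
        by_contra! hbz
        exact absurd (hb.trans_le (monotone_cdf μ hbz.le)) (not_lt.2 hz)
      have hmem := (isClosed_Iic.preimage hcont).csSup_mem hS hbdd
      -- The function may be flat at level u; a is the last point of the sublevel set, and
      -- continuity gives it the value u exactly.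
      set a := sSup (cdf μ ⁻¹' Iic u)
      have hIic : cdf μ ⁻¹' Iic u = Iic a := by
        ext z; constructor
        · exact fun hz => le_csSup hbdd hz
        · exact fun hz => (monotone_cdf μ hz).trans hmem
      have hge : u ≤ cdf μ a := by
        refine ge_of_tendsto (hcont.continuousAt.tendsto.mono_left
          (nhdsWithin_le_nhds : 𝓝[>] a ≤ 𝓝 a)) ?_
        filter_upwards [self_mem_nhdsWithin] with z hz
        by_contra! hzu
        exact absurd (le_csSup hbdd (show z ∈ cdf μ ⁻¹' Iic u from hzu.le)) (not_le.2 hz)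
      rw [hIic, ← ofReal_cdf, le_antisymm hmem hge]
  · have hE : Iic u ∩ Ioo (0 : ℝ) 1 = Ioo 0 1 :=
      inter_eq_right.2 fun x hx => hx.2.le.trans hu1
    have hE' : cdf μ ⁻¹' Iic u = univ := eq_univ_of_forall fun z => (cdf_le_one μ z).trans hu1
    simp [hE, hE']

/-! ### Marginal densities and conditional laws -/

section Marginal

variable {K : ℕ} {q : (Fin K → ℝ) → ℝ≥0}

theorem measurable_marginalDensity (hq : Measurable q) (k : ℕ) :
    Measurable (marginalDensity q k) :=
  (hq.coe_nnreal_ennreal).lmarginal _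

theorem measurable_marginalDensity_update (hq : Measurable q) (k : ℕ) (j : Fin K)
    (x : Fin K → ℝ) : Measurable fun z => marginalDensity q k (update x j z) :=
  (measurable_marginalDensity hq k).comp (measurable_update x)

theorem marginalDensity_self (x : Fin K → ℝ) : marginalDensity q K x = q x := by
  have : (Finset.univ.filter fun j : Fin K => K ≤ (j : ℕ)) = ∅ := by
    ext j; simp
  simp [marginalDensity, this]

theorem marginalDensity_zero (x : Fin K → ℝ) : marginalDensity q 0 x = ∫⁻ y, (q y : ℝ≥0∞) := by
  simp [marginalDensity, volume_pi]

theorem marginalDensity_congr {k : ℕ} {x y : Fin K → ℝ} (h : ∀ i : Fin K, (i : ℕ) < k → x i = y i) :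
    marginalDensity q k x = marginalDensity q k y :=
  lmarginal_congr _ _ fun i hi => h i (by simpa using hi)

theorem marginalDensity_update {k : ℕ} {j : Fin K} (h : k ≤ j) (x : Fin K → ℝ) (z : ℝ) :
    marginalDensity q k (update x j z) = marginalDensity q k x :=
  marginalDensity_congr fun i hi => update_of_ne (by rintro rfl; omega) _ _

theorem marginalDensity_eq_lintegral (hq : Measurable q) (j : Fin K) (x : Fin K → ℝ) :
    marginalDensity q j x = ∫⁻ z, marginalDensity q (j + 1) (update x j z) := by
  have : (Finset.univ.filter fun i : Fin K => (j : ℕ) ≤ i) =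
      insert j (Finset.univ.filter fun i : Fin K => (j : ℕ) + 1 ≤ i) := by
    ext i; simp [Fin.ext_iff]; omega
  rw [marginalDensity, this, lmarginal_insert _ hq.coe_nnreal_ennreal (by simp)]
  rfl

theorem condDensity_update (j : Fin K) (x : Fin K → ℝ) (z : ℝ) :
    condDensity q j (update x j z) = condDensity q j x := by
  ext w; simp [condDensity, marginalDensity_update le_rfl]

theorem condDensity_congr {j : Fin K} {x y : Fin K → ℝ} (h : ∀ i < j, x i = y i) :
    condDensity q j x = condDensity q j y := by
  ext w
  rw [condDensity, condDensity, marginalDensity_congr (x := x) (y := y) fun i hi => h i hi]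
  congr 1
  refine marginalDensity_congr fun i hi => ?_
  rcases eq_or_ne i j with rfl | hij
  · simp
  · rw [update_of_ne hij, update_of_ne hij]
    exact h i (lt_of_le_of_ne (Fin.le_def.2 (by omega)) hij)

/-- The triangular shape of φ, behind both injectivity and the factorisation through `partialPhi`.
-/
theorem phi_congr {j : Fin K} {x y : Fin K → ℝ} (h : ∀ i ≤ j, x i = y i) :
    phi q x j = phi q y j := by
  simp only [phi, condLaw]
  rw [condDensity_congr fun i hi => h i hi.le, h j le_rfl]

theorem phi_update (j : Fin K) (x : Fin K → ℝ) (z : ℝ) :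
    phi q (update x j z) j = (condLaw q j x).real (Iic z) := by
  simp [phi, condLaw, condDensity_update]

theorem measurable_condDensity (hq : Measurable q) (j : Fin K) (x : Fin K → ℝ) :
    Measurable (condDensity q j x) :=
  (measurable_marginalDensity_update hq _ j x).div_const _

theorem isProbabilityMeasure_condLaw (hq : Measurable q) {j : Fin K} {x : Fin K → ℝ}
    (h0 : marginalDensity q j x ≠ 0) (htop : marginalDensity q j x ≠ ∞) :
    IsProbabilityMeasure (condLaw q j x) := by
  constructor
  rw [condLaw, withDensity_apply _ .univ, Measure.restrict_univ]
  simp_rw [condDensity, div_eq_mul_inv]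
  rw [lintegral_mul_const _ (measurable_marginalDensity_update hq _ j x),
    ← marginalDensity_eq_lintegral hq, ENNReal.mul_inv_cancel h0 htop]

theorem phi_eq (hq : Measurable q) (x : Fin K → ℝ) (j : Fin K) :
    phi q x j = ((∫⁻ z in Iic (x j), marginalDensity q (j + 1) (update x j z)) /
      marginalDensity q j x).toReal := by
  rw [phi, measureReal_def, condLaw, withDensity_apply _ measurableSet_Iic]
  simp_rw [condDensity, div_eq_mul_inv]
  rw [lintegral_mul_const _ (measurable_marginalDensity_update hq _ j x)]

theorem measurable_phi (hq : Measurable q) : Measurable (phi q) := by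
  refine measurable_pi_iff.2 fun j => ?_
  simp_rw [phi_eq hq]
  refine (Measurable.div ?_ (measurable_marginalDensity hq _)).ennreal_toReal
  simp_rw [← lintegral_indicator measurableSet_Iic]
  -- The upper limit also varies with x, so it is absorbed into a jointly measurable indicator.
  have hm : Measurable fun p : (Fin K → ℝ) × ℝ =>
      {p : (Fin K → ℝ) × ℝ | p.2 ≤ p.1 j}.indicator
        (fun p => marginalDensity q (j + 1) (update p.1 j p.2)) p := by
    refine Measurable.indicator ((measurable_marginalDensity hq _).comp ?_)
      (measurableSet_le (by fun_prop) (by fun_prop))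
    exact (by fun_prop : Continuous fun p : (Fin K → ℝ) × ℝ => update p.1 j p.2).measurable
  exact hm.lintegral_prod_right'

end Marginal

/-! ### Replacing one coordinate at a time -/

/-- A probability density all of whose marginal densities are finite and continuous. -/
structure RegularDensity {K : ℕ} (q : (Fin K → ℝ) → ℝ≥0) : Prop where
  lintegral_eq_one : ∫⁻ x, (q x : ℝ≥0∞) = 1
  ne_top : ∀ k ≤ K, ∀ x, marginalDensity q k x ≠ ∞
  continuous_marginal : ∀ k ≤ K, Continuous (marginalDensity q k)

/-- The map that replaces the coordinates of index at least `m` by their multivariate p-values. -/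
noncomputable def partialPhi {K : ℕ} (q : (Fin K → ℝ) → ℝ≥0) (m : ℕ) (x : Fin K → ℝ) :
    Fin K → ℝ :=
  fun j => if m ≤ j then phi q x j else x j

/-- The indicator that the coordinates of index at least `m` lie in `(0, 1)`. -/
noncomputable def unitTail {K : ℕ} (m : ℕ) (x : Fin K → ℝ) : ℝ≥0∞ :=
  ∏ i ∈ Finset.univ.filter fun i : Fin K => m ≤ (i : ℕ), (Ioo (0 : ℝ) 1).indicator 1 (x i)

theorem measurable_unitTail {K : ℕ} (m : ℕ) : Measurable (unitTail (K := K) m) := by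
  refine Finset.measurable_prod _ fun i _ => ?_
  exact (measurable_one.indicator measurableSet_Ioo).comp (measurable_pi_apply i)

theorem unitTail_eq_mul {K : ℕ} (j : Fin K) (x : Fin K → ℝ) :
    unitTail j x = (Ioo (0 : ℝ) 1).indicator 1 (x j) * unitTail (j + 1) x := by
  have : (Finset.univ.filter fun i : Fin K => (j : ℕ) ≤ i) =
      insert j (Finset.univ.filter fun i : Fin K => (j : ℕ) + 1 ≤ i) := by
    ext i; simp [Fin.ext_iff]; omega
  rw [unitTail, this, Finset.prod_insert (by simp)]
  rfl

theorem unitTail_succ_update {K : ℕ} (j : Fin K) (x : Fin K → ℝ) (z : ℝ) :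
    unitTail (j + 1) (update x j z) = unitTail (j + 1) x := by
  refine Finset.prod_congr rfl fun i hi => ?_
  rw [update_of_ne]
  rintro rfl
  simp at hi

theorem unitTail_self {K : ℕ} (x : Fin K → ℝ) : unitTail K x = 1 := by
  refine Finset.prod_eq_one fun i hi => ?_
  exact absurd (Finset.mem_filter.1 hi).2 (not_le.2 i.isLt)

theorem unitTail_zero {K : ℕ} :
    unitTail (K := K) 0 = (univ.pi fun _ => Ioo (0 : ℝ) 1).indicator 1 := by
  ext x
  by_cases hx : x ∈ univ.pi fun _ : Fin K => Ioo (0 : ℝ) 1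
  · rw [indicator_of_mem hx]
    exact Finset.prod_eq_one fun i _ => indicator_of_mem (hx i trivial) _
  · rw [indicator_of_notMem hx]
    simp only [mem_univ_pi, not_forall] at hx
    obtain ⟨i, hi⟩ := hx
    exact Finset.prod_eq_zero (i := i) (by simp) (indicator_of_notMem hi _)

variable {K : ℕ} {q : (Fin K → ℝ) → ℝ≥0}

/-- Going from the last coordinate to the first leaves everything up to j untouched when φ_j is
evaluated, so it can be read off the partly transformed point. -/
theorem partialPhi_eq_update (j : Fin K) (x : Fin K → ℝ) :
    partialPhi q j x =
      update (partialPhi q (j + 1) x) j (phi q (partialPhi q (j + 1) x) j) := by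
  have hj : phi q (partialPhi q (j + 1) x) j = phi q x j := by
    refine phi_congr fun i hi => ?_
    rw [partialPhi, if_neg]
    have := Fin.le_def.1 hi
    omega
  rw [hj]
  ext i
  rcases eq_or_ne i j with rfl | hij
  · simp [partialPhi]
  · rw [update_of_ne hij]
    have : (i : ℕ) ≠ j := fun h => hij (Fin.ext h)
    simp only [partialPhi]
    congr 1
    simp only [eq_iff_iff]; omega

theorem partialPhi_self (x : Fin K → ℝ) : partialPhi q K x = x := by
  ext i; simp [partialPhi]

theorem partialPhi_zero : partialPhi q 0 = phi q := by
  ext x i; simp [partialPhi]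

theorem measurable_partialPhi (hq : Measurable q) (m : ℕ) : Measurable (partialPhi q m) := by
  refine measurable_pi_iff.2 fun j => ?_
  by_cases h : m ≤ j
  · simpa [partialPhi, h] using (measurable_pi_iff.1 (measurable_phi hq) j)
  · simpa [partialPhi, h] using measurable_pi_apply j

/-- Replacing the coordinate `j` by its conditional p-value makes it uniform and independent of
the previous coordinates. -/
theorem map_update_phi (hm : Measurable q) (j : Fin K)
    (htop : ∀ x, marginalDensity q j x ≠ ∞) :
    (volume.withDensity fun x => marginalDensity q (j + 1) x * unitTail (j + 1) x).map
        (fun x => update x j (phi q x j)) =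
      volume.withDensity fun x => marginalDensity q j x * unitTail j x := by
  have hT : Measurable fun x : Fin K → ℝ => update x j (phi q x j) := by
    refine measurable_update'.comp (measurable_id.prodMk ?_)
    exact measurable_pi_iff.1 (measurable_phi hm) j
  have hM := measurable_marginalDensity hm
  ext A hA
  have h1A : Measurable (A.indicator (1 : (Fin K → ℝ) → ℝ≥0∞)) := measurable_one.indicator hA
  rw [Measure.map_apply hT hA, withDensity_apply _ (hT hA), withDensity_apply _ hA,
    ← lintegral_indicator (hT hA), ← lintegral_indicator hA]
  -- Only coordinate j moves, so by Tonelli it suffices to compare integrals over it with the others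
  -- frozen.
  refine lintegral_eq_of_lmarginal_eq (μ := fun _ => volume) {j}
    (((hM _).mul (measurable_unitTail _)).indicator (hT hA))
    (((hM _).mul (measurable_unitTail _)).indicator hA) ?_
  ext x
  rw [lmarginal_singleton, lmarginal_singleton]
  have hL : ∀ z, ((fun x => update x j (phi q x j)) ⁻¹' A).indicator
      (fun x => marginalDensity q (j + 1) x * unitTail (j + 1) x) (update x j z) =
      A.indicator 1 (update x j ((condLaw q j x).real (Iic z))) *
        (marginalDensity q (j + 1) (update x j z) * unitTail (j + 1) x) := fun z => by
    have : update (update x j z) j (phi q (update x j z) j) =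
        update x j ((condLaw q j x).real (Iic z)) := by simp [phi_update]
    by_cases h : update x j ((condLaw q j x).real (Iic z)) ∈ A
    · rw [indicator_of_mem (by rwa [mem_preimage, this]), indicator_of_mem h,
        unitTail_succ_update]
      simp
    · rw [indicator_of_notMem (by rwa [mem_preimage, this]), indicator_of_notMem h, zero_mul]
  have hR : ∀ z, A.indicator (fun x => marginalDensity q j x * unitTail j x) (update x j z) =
      (marginalDensity q j x * unitTail (j + 1) x) *
        (Ioo 0 1).indicator (fun z => A.indicator 1 (update x j z)) z := fun z => by
    by_cases h : update x j z ∈ A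
    · rw [indicator_of_mem h, marginalDensity_update le_rfl, unitTail_eq_mul, unitTail_succ_update]
      by_cases hz : z ∈ Ioo (0 : ℝ) 1 <;> simp [h, hz]
    · by_cases hz : z ∈ Ioo (0 : ℝ) 1 <;> simp [h, hz]
  simp_rw [hL, hR]
  have hup : Measurable fun z : ℝ => A.indicator (1 : (Fin K → ℝ) → ℝ≥0∞) (update x j z) :=
    h1A.comp (measurable_update x)
  rw [lintegral_const_mul _ (hup.indicator measurableSet_Ioo)]
  -- Where the conditioning density vanishes the conditional law is meaningless, but the next
  -- marginal is then zero for almost every z and both sides vanish.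
  rcases eq_or_ne (marginalDensity q j x) 0 with h0 | h0
  · rw [h0, zero_mul, zero_mul]
    rw [marginalDensity_eq_lintegral hm, lintegral_eq_zero_iff (measurable_marginalDensity_update hm _ j x)]
      at h0
    refine lintegral_eq_zero_of_ae_eq_zero ?_
    filter_upwards [h0] with z hz
    simp only [Pi.zero_apply] at hz ⊢
    rw [hz, zero_mul, mul_zero]
  · have := isProbabilityMeasure_condLaw hm h0 (htop x)
    have : NullSingletonClass (condLaw q j x) := by unfold condLaw; infer_instance
    have hF : Measurable fun z => (condLaw q j x).real (Iic z) :=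
      Monotone.measurable fun a b hab => measureReal_mono (Iic_subset_Iic.2 hab)
    have hc : ∀ z, marginalDensity q (j + 1) (update x j z) =
        condDensity q j x z * marginalDensity q j x := fun z =>
      (ENNReal.div_mul_cancel h0 (htop x)).symm
    calc _ = ∫⁻ z, (marginalDensity q j x * unitTail (j + 1) x) * (condDensity q j x z *
          A.indicator 1 (update x j ((condLaw q j x).real (Iic z)))) := by
          congr 1; ext z; rw [hc]; ring
      _ = (marginalDensity q j x * unitTail (j + 1) x) * ∫⁻ z, condDensity q j x z *
          A.indicator 1 (update x j ((condLaw q j x).real (Iic z))) :=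
          lintegral_const_mul _ ((measurable_condDensity hm j x).mul (hup.comp hF))
      _ = (marginalDensity q j x * unitTail (j + 1) x) *
          ∫⁻ z, A.indicator 1 (update x j ((condLaw q j x).real (Iic z))) ∂condLaw q j x := by
          congr 1
          exact (lintegral_withDensity_eq_lintegral_mul _ (measurable_condDensity hm j x)
            (hup.comp hF)).symm
      _ = _ := by
          rw [lintegral_indicator measurableSet_Ioo, ← map_cdf_eq_uniform (condLaw q j x),
            lintegral_map hup hF]

/-! ### Continuity, injectivity and openness of φ -/

namespace RegularDensity

theorem measurable (h : RegularDensity q) : Measurable q := by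
  have := (h.continuous_marginal K le_rfl).measurable
  simp_rw [funext marginalDensity_self] at this
  simpa using this.ennreal_toNNReal

theorem continuous (h : RegularDensity q) : Continuous q := by
  have := h.continuous_marginal K le_rfl
  simp_rw [funext marginalDensity_self] at this
  exact ENNReal.continuous_coe_iff.1 this

theorem isOpen_sppt (h : RegularDensity q) : IsOpen (sppt q) :=
  isOpen_lt continuous_const h.continuous

/-- By continuity, positivity at one point spreads to an open set of z, which has positive length.
-/
theorem pos_of_pos_succ (h : RegularDensity q) {j : Fin K} {x : Fin K → ℝ}
    (hx : 0 < marginalDensity q (j + 1) x) : 0 < marginalDensity q j x := by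
  rw [marginalDensity_eq_lintegral h.measurable]
  have hc : Continuous fun z => marginalDensity q (j + 1) (update x j z) :=
    (h.continuous_marginal _ j.isLt).comp (by fun_prop)
  rw [lintegral_pos_iff_support hc.measurable]
  refine (isOpen_ne_fun hc continuous_const).measure_pos _ ⟨x j, ?_⟩
  simpa using hx.ne'

theorem pos_of_mem_sppt (h : RegularDensity q) {x : Fin K → ℝ} (hx : x ∈ sppt q) {k : ℕ}
    (hk : k ≤ K) : 0 < marginalDensity q k x := by
  induction hk using Nat.decreasingInduction with
  | self => simpa [marginalDensity_self, sppt] using hx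
  | of_succ k hk ih => exact h.pos_of_pos_succ (j := ⟨k, hk⟩) ih

theorem continuousOn_phi_apply (h : RegularDensity q) (j : Fin K) :
    ContinuousOn (fun x => phi q x j) {x | 0 < marginalDensity q j x} := by
  simp_rw [phi_eq h.measurable]
  have hF := marginalDensity_eq_lintegral h.measurable j
  have hN := continuous_lintegral_Iic j (h.continuous_marginal (j + 1) j.isLt)
    (by simpa only [← hF] using h.continuous_marginal j j.isLt.le)
    (by simpa only [← hF] using h.ne_top j j.isLt.le)
  have hle : ∀ x, ∫⁻ z in Iic (x j), marginalDensity q (j + 1) (update x j z) ≠ ∞ := fun x =>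
    ne_top_of_le_ne_top (h.ne_top j j.isLt.le x)
      ((setLIntegral_le_lintegral _ _).trans_eq (hF x).symm)
  intro x hx
  refine ContinuousAt.continuousWithinAt ?_
  have hd := ENNReal.Tendsto.div (hN.tendsto x) (.inr hx.ne')
    ((h.continuous_marginal j j.isLt.le).tendsto x) (.inr (hle x))
  exact (ENNReal.tendsto_toReal (ENNReal.div_ne_top (hle x) hx.ne')).comp hd

/-- The increment is the conditional mass of (a, b]. Positivity at c, possibly an endpoint, spreads
to a nonempty open part of (a, b). -/
theorem phi_lt (h : RegularDensity q) {j : Fin K} {x : Fin K → ℝ} {a b : ℝ} (hab : a < b)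
    {c : ℝ} (hc : c ∈ Icc a b) (hx : 0 < marginalDensity q (j + 1) (update x j c)) :
    phi q (update x j a) j < phi q (update x j b) j := by
  rw [phi_update, phi_update]
  have hpos : 0 < marginalDensity q j x := by
    simpa [marginalDensity_update le_rfl] using h.pos_of_pos_succ hx
  have := isProbabilityMeasure_condLaw h.measurable hpos.ne' (h.ne_top j j.isLt.le x)
  have hcont : Continuous fun z => marginalDensity q (j + 1) (update x j z) :=
    (h.continuous_marginal _ j.isLt).comp (by fun_prop)
  rw [← Iic_union_Ioc_eq_Iic hab.le, measureReal_union (by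
    rw [disjoint_left]; exact fun z hz hz' => absurd hz'.1 (not_lt.2 hz)) measurableSet_Ioc]
  refine lt_add_of_pos_right _ (ENNReal.toReal_pos ?_ (measure_ne_top _ _))
  rw [condLaw, withDensity_apply _ measurableSet_Ioc]
  refine ne_of_gt ?_
  rw [setLIntegral_pos_iff (measurable_condDensity h.measurable j x)]
  have hO : IsOpen {z | 0 < marginalDensity q (j + 1) (update x j z)} :=
    isOpen_lt continuous_const hcont
  have hne : ({z | 0 < marginalDensity q (j + 1) (update x j z)} ∩ Ioo a b).Nonempty := by
    have : c ∈ closure (Ioo a b) := by rwa [closure_Ioo hab.ne]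
    exact mem_closure_iff.1 this _ hO hx
  refine ((hO.inter isOpen_Ioo).measure_pos volume hne).trans_le (measure_mono ?_)
  rintro z ⟨hz, hz'⟩
  refine ⟨?_, hz'.1, hz'.2.le⟩
  exact (ENNReal.div_pos (ne_of_gt hz) (h.ne_top j j.isLt.le x)).ne'

theorem continuousOn_phi (h : RegularDensity q) : ContinuousOn (phi q) (sppt q) :=
  continuousOn_pi.2 fun j => (h.continuousOn_phi_apply j).mono
    fun _ hx => h.pos_of_mem_sppt hx j.isLt.le

theorem mapsTo_phi (h : RegularDensity q) : MapsTo (phi q) (sppt q) (Icc 0 1) := by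
  intro x hx
  refine ⟨fun j => measureReal_nonneg, fun j => ?_⟩
  have := isProbabilityMeasure_condLaw h.measurable (h.pos_of_mem_sppt hx j.isLt.le).ne'
    (h.ne_top j j.isLt.le x)
  exact measureReal_le_one

theorem injOn_phi (h : RegularDensity q) : InjOn (phi q) (sppt q) := by
  have key : ∀ x ∈ sppt q, ∀ y : Fin K → ℝ, ∀ j : Fin K, phi q x j = phi q y j →
      (∀ i < j, x i = y i) → x j = y j := fun x hx y j hxy hlt => by
    have hy : phi q y j = phi q (update x j (y j)) j := by
      refine phi_congr fun i hi => ?_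
      rcases eq_or_ne i j with rfl | hij
      · simp
      · rw [update_of_ne hij, hlt i (lt_of_le_of_ne hi hij)]
    have hx' : phi q x j = phi q (update x j (x j)) j := by simp
    have hpos : 0 < marginalDensity q (j + 1) (update x j (x j)) := by
      simpa using h.pos_of_mem_sppt hx j.isLt
    rcases lt_trichotomy (x j) (y j) with hlt | heq | hlt
    · have := h.phi_lt hlt (left_mem_Icc.2 hlt.le) hpos
      linarith
    · exact heq
    · have := h.phi_lt hlt (right_mem_Icc.2 hlt.le) hpos
      linarith
  intro x hx y _ hxy
  ext j
  induction j using WellFoundedLT.induction with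
  | ind j ih => exact key x hx y j (congrFun hxy j) ih

theorem isOpen_image_partialPhi (h : RegularDensity q) {W : Set (Fin K → ℝ)} (hW : IsOpen W)
    (hWs : W ⊆ sppt q) {m : ℕ} (hm : m ≤ K) : IsOpen (partialPhi q m '' W) := by
  induction hm using Nat.decreasingInduction with
  | self => simpa [funext partialPhi_self] using hW
  | of_succ m hm ih =>
    -- The image may leave the support of q, but its first m + 1 coordinates are unchanged and this
    -- marginal sees no others.
    have hsub : ∀ x ∈ partialPhi q (m + 1) '' W, 0 < marginalDensity q (m + 1) x := by
      rintro _ ⟨x, hx, rfl⟩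
      rw [marginalDensity_congr (y := x)]
      · exact h.pos_of_mem_sppt (hWs hx) hm
      · exact fun i hi => if_neg (by omega)
    have := isOpen_image_update (⟨m, hm⟩ : Fin K) (ψ := fun x => phi q x ⟨m, hm⟩) ih
      ((h.continuousOn_phi_apply ⟨m, hm⟩).mono fun x hx => h.pos_of_pos_succ (hsub x hx))
      fun x a b hab hz => h.phi_lt hab (left_mem_Icc.2 hab.le)
        (hsub _ (hz a (left_mem_Icc.2 hab.le)))
    rw [image_image] at this
    convert this using 2 with x
    exact partialPhi_eq_update ⟨m, hm⟩ x

theorem isOpen_image_phi (h : RegularDensity q) {W : Set (Fin K → ℝ)} (hW : IsOpen W)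
    (hWs : W ⊆ sppt q) : IsOpen (phi q '' W) := by
  simpa [partialPhi_zero] using h.isOpen_image_partialPhi hW hWs (Nat.zero_le K)

/-! ### Laws of φ(X) under the null and the alternative -/

theorem map_partialPhi (h : RegularDensity q) {m : ℕ} (hm : m ≤ K) :
    (law q).map (partialPhi q m) =
      volume.withDensity fun x => marginalDensity q m x * unitTail m x := by
  induction hm using Nat.decreasingInduction with
  | self =>
    rw [funext partialPhi_self, Measure.map_id']
    simp [law, marginalDensity_self, unitTail_self]
  | of_succ m hm ih =>
    rw [← map_update_phi h.measurable ⟨m, hm⟩ (h.ne_top m hm.le), ← ih, Measure.map_map ?_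
      (measurable_partialPhi h.measurable _)]
    · congr 1
      ext1 x
      exact partialPhi_eq_update ⟨m, hm⟩ x
    · refine measurable_update'.comp (measurable_id.prodMk ?_)
      exact measurable_pi_iff.1 (measurable_phi h.measurable) _

theorem map_phi (h : RegularDensity q) :
    (law q).map (phi q) = volume.restrict (univ.pi fun _ => Ioo (0 : ℝ) 1) := by
  have := h.map_partialPhi (Nat.zero_le K)
  simp_rw [marginalDensity_zero, h.lintegral_eq_one, one_mul, partialPhi_zero, unitTail_zero] at this
  rw [this, withDensity_indicator_one (MeasurableSet.univ_pi fun _ => measurableSet_Ioo)]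

theorem law_compl_sppt (h : RegularDensity q) : law q (sppt q)ᶜ = 0 := by
  have hm := h.isOpen_sppt.measurableSet.compl
  rw [law, withDensity_apply _ hm]
  refine setLIntegral_eq_zero hm fun x hx => ?_
  simpa [sppt] using hx

theorem isOpen_pRange (h : RegularDensity q) : IsOpen (pRange q) :=
  h.isOpen_image_phi h.isOpen_sppt subset_rfl

/-- The law of X sits on the support, so its image, which is Lebesgue measure on the cube, sits on
E. -/
theorem volume_Icc_diff_pRange (h : RegularDensity q) :
    volume (Icc (0 : Fin K → ℝ) 1 \ pRange q) = 0 := by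
  have hE := h.isOpen_pRange.measurableSet
  have h1 : (law q).map (phi q) (pRange q)ᶜ = 0 := by
    rw [Measure.map_apply (measurable_phi h.measurable) hE.compl]
    refine measure_mono_null ?_ h.law_compl_sppt
    exact fun x hx hxs => hx (mem_image_of_mem _ hxs)
  rw [h.map_phi, volume_pi, Measure.restrict_congr_set
    (Measure.univ_pi_Ioo_ae_eq_Icc (f := fun _ => 0) (g := fun _ => 1)),
    Measure.restrict_apply hE.compl] at h1
  rwa [sdiff_eq, inter_comm]

theorem restrict_pRange (h : RegularDensity q) :
    volume.restrict (pRange q) = volume.restrict (univ.pi fun _ : Fin K => Ioo (0 : ℝ) 1) := by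
  refine Measure.restrict_congr_set (EventuallyEq.trans ?_
    (Measure.univ_pi_Ioo_ae_eq_Icc (f := 0) (g := 1)).symm)
  refine eventuallyEq_of_mem (s := (Icc 0 1 \ pRange q)ᶜ) ?_ ?_
  · exact compl_mem_ae_iff.2 h.volume_Icc_diff_pRange
  · intro x hx
    refine propext ⟨?_, fun hx' => by_contra fun h' => hx ⟨hx', h'⟩⟩
    rintro ⟨y, hy, rfl⟩
    exact h.mapsTo_phi hy

theorem _root_.MultPValue.phiInv_mem {u : Fin K → ℝ} (hu : u ∈ pRange q) :
    phiInv q u ∈ sppt q :=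
  invFunOn_mem hu

theorem phiInv_phi (h : RegularDensity q) {x : Fin K → ℝ} (hx : x ∈ sppt q) :
    phiInv q (phi q x) = x :=
  h.injOn_phi.leftInvOn_invFunOn hx

/-- Preimages under the inverse are images under φ, so this is openness of φ. -/
theorem continuousOn_phiInv (h : RegularDensity q) : ContinuousOn (phiInv q) (pRange q) := by
  rw [continuousOn_open_iff h.isOpen_pRange]
  intro V hV
  convert h.isOpen_image_phi (hV.inter h.isOpen_sppt) inter_subset_right using 1
  ext u; constructor
  · rintro ⟨⟨x, hx, rfl⟩, hV⟩
    exact ⟨x, ⟨by rwa [mem_preimage, h.phiInv_phi hx] at hV, hx⟩, rfl⟩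
  · rintro ⟨x, ⟨hV, hx⟩, rfl⟩
    exact ⟨mem_image_of_mem _ hx, by rwa [mem_preimage, h.phiInv_phi hx]⟩

theorem continuousOn_likelihoodRatio (h : RegularDensity q) {q₁ : (Fin K → ℝ) → ℝ≥0}
    (hq₁ : ContinuousOn q₁ (sppt q)) : ContinuousOn (likelihoodRatio q q₁) (pRange q) :=
  (hq₁.comp h.continuousOn_phiInv fun _ hu => phiInv_mem hu).div
    (h.continuous.comp_continuousOn h.continuousOn_phiInv) fun _ hu => ne_of_gt (phiInv_mem hu)

theorem map_phi_law (h : RegularDensity q) {q₁ : (Fin K → ℝ) → ℝ≥0}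
    (hs : sppt q₁ ⊆ sppt q) (hq₁ : ContinuousOn q₁ (sppt q)) :
    (law q₁).map (phi q) = (volume.restrict (pRange q)).withDensity
      fun u => (likelihoodRatio q q₁ u : ℝ≥0∞) := by
  have hφ := measurable_phi h.measurable
  have hE := h.isOpen_pRange.measurableSet
  classical
  -- Values of `phiInv` off E are arbitrary; extending the ratio by zero makes it globally
  -- measurable.
  set g : (Fin K → ℝ) → ℝ≥0 := (pRange q).piecewise (likelihoodRatio q q₁) 0 with hgdef
  have hg : Measurable fun u => (g u : ℝ≥0∞) :=
    ((h.continuousOn_likelihoodRatio hq₁).measurable_piecewise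
      continuous_zero.continuousOn hE).coe_nnreal_ennreal
  have hae : (fun u => (likelihoodRatio q q₁ u : ℝ≥0∞)) =ᵐ[volume.restrict (pRange q)]
      fun u => (g u : ℝ≥0∞) := by
    filter_upwards [ae_restrict_mem hE] with u hu
    simp [hgdef, hu]
  -- On the support this undoes the quotient; off it both densities vanish by the inclusion of
  -- supports.
  have hpt : ∀ x, (q₁ x : ℝ≥0∞) = q x * g (phi q x) := fun x => by
    rw [← ENNReal.coe_mul, ENNReal.coe_inj]
    by_cases hx : x ∈ sppt q
    · have hu : phi q x ∈ pRange q := mem_image_of_mem _ hx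
      rw [hgdef, piecewise_eq_of_mem _ _ _ hu, likelihoodRatio, h.phiInv_phi hx,
        mul_div_cancel₀ _ (ne_of_gt hx)]
    · have h0 : q x = 0 := by simpa [sppt] using hx
      have h1 : q₁ x = 0 := by simpa [sppt] using fun h' => hx (hs h')
      rw [h0, h1, zero_mul]
  have hgφ : Measurable fun x => (g (phi q x) : ℝ≥0∞) := hg.comp hφ
  rw [withDensity_congr_ae hae, h.restrict_pRange, ← h.map_phi]
  ext A hA
  rw [Measure.map_apply hφ hA, law, withDensity_apply _ (hφ hA), withDensity_apply _ hA,
    setLIntegral_map hA hg hφ, law, setLIntegral_withDensity_eq_setLIntegral_mul _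
      h.measurable.coe_nnreal_ennreal hgφ (hφ hA)]
  exact lintegral_congr hpt

end RegularDensity

/-- The remaining case k = 0 is the constant total mass 1. -/
theorem RegularDensity.of_marginals {K : ℕ} {q : (Fin K → ℝ) → ℝ≥0}
    (hq : ∫⁻ x, (q x : ℝ≥0∞) = 1)
    (h_fin : ∀ k : ℕ, 1 ≤ k → k ≤ K → ∀ x, marginalDensity q k x ≠ ∞)
    (h_cont : ∀ k : ℕ, 1 ≤ k → k ≤ K → Continuous (marginalDensity q k)) :
    RegularDensity q where
  lintegral_eq_one := hq
  ne_top k hk x := by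
    rcases Nat.eq_zero_or_pos k with rfl | h0
    · simp [marginalDensity_zero, hq]
    · exact h_fin k h0 hk x
  continuous_marginal k hk := by
    rcases Nat.eq_zero_or_pos k with rfl | h0
    · simpa only [funext marginalDensity_zero] using continuous_const
    · exact h_cont k h0 hk

theorem map_phi_comp {K : ℕ} {q p : (Fin K → ℝ) → ℝ≥0} (hq : Measurable q) {Ω : Type*}
    [MeasurableSpace Ω] {P : Measure Ω} {X : Ω → Fin K → ℝ} (hX : HasLaw X (law p) P) :
    P.map (fun ω => phi q (X ω)) = (law p).map (phi q) := by
  rw [← hX.map_eq, AEMeasurable.map_map_of_aemeasurable (measurable_phi hq).aemeasurable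
    hX.aemeasurable]
  rfl

/-- Random variables whose joint law is uniform on the open unit cube are i.i.d. uniform. -/
theorem iIndepFun_and_hasLaw_of_map_eq {K : ℕ} {Ω : Type*} [MeasurableSpace Ω] {P : Measure Ω}
    [IsProbabilityMeasure P] {Y : Ω → Fin K → ℝ} (hY : AEMeasurable Y P)
    (hmap : P.map Y = volume.restrict (univ.pi fun _ => Ioo (0 : ℝ) 1)) :
    iIndepFun (fun (j : Fin K) ω => Y ω j) P ∧
      ∀ j : Fin K, HasLaw (fun ω => Y ω j) (volume.restrict (Ioo (0 : ℝ) 1)) P := by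
  have hj : ∀ j, AEMeasurable (fun ω => Y ω j) P := aemeasurable_pi_iff.1 hY
  have : IsProbabilityMeasure (volume.restrict (Ioo (0 : ℝ) 1)) := ⟨by simp⟩
  rw [volume_pi, Measure.restrict_pi_pi] at hmap
  have hlaw : ∀ j : Fin K, P.map (fun ω => Y ω j) = volume.restrict (Ioo (0 : ℝ) 1) := fun j => by
    rw [← (measurePreserving_eval (fun _ : Fin K => volume.restrict (Ioo (0 : ℝ) 1)) j).map_eq,
      ← hmap, AEMeasurable.map_map_of_aemeasurable (measurable_pi_apply j).aemeasurable hY]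
    rfl
  refine ⟨?_, fun j => ⟨hj j, hlaw j⟩⟩
  rw [iIndepFun_iff_map_fun_eq_pi_map hj]
  simp_rw [hlaw]
  exact hmap

end MultPValue

end

open MultPValue in
theorem lemma3p1 {K : ℕ} (q₀ q₁ : (Fin K → ℝ) → ℝ≥0)
    (hq₀ : ∫⁻ x, (q₀ x : ℝ≥0∞) = 1) (hq₁ : ∫⁻ x, (q₁ x : ℝ≥0∞) = 1)
    (h_sppt : sppt q₁ ⊆ sppt q₀)
    (h_fin : ∀ k : ℕ, 1 ≤ k → k ≤ K → ∀ x, marginalDensity q₀ k x ≠ ∞)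
    (h_cont : ∀ k : ℕ, 1 ≤ k → k ≤ K → Continuous (marginalDensity q₀ k))
    (hq₁_cont : ContinuousOn q₁ (sppt q₀)) :
    -- the map `φ : sppt q₀ → [0, 1]^K` is continuous and one-to-one
    (MapsTo (phi q₀) (sppt q₀) (Icc 0 1) ∧
      ContinuousOn (phi q₀) (sppt q₀) ∧
      InjOn (phi q₀) (sppt q₀)) ∧
    -- under the null, the coordinates of `ξ = φ(X)` are i.i.d. uniform
    (∀ {Ω : Type*} [MeasurableSpace Ω] (P : Measure Ω) [IsProbabilityMeasure P]
        (X : Ω → Fin K → ℝ), HasLaw X (law q₀) P →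
      iIndepFun (fun (j : Fin K) ω => phi q₀ (X ω) j) P ∧
      ∀ j : Fin K, HasLaw (fun ω => phi q₀ (X ω) j) (volume.restrict (Ioo (0 : ℝ) 1)) P) ∧
    -- the set `E` is open and of full measure in `[0, 1]^K`
    (IsOpen (pRange q₀) ∧ volume (Icc (0 : Fin K → ℝ) 1 \ pRange q₀) = 0) ∧
    -- under the alternative, `ξ = φ(X)` has the density `g` on `E`, and `g` is continuous on `E`
    (ContinuousOn (likelihoodRatio q₀ q₁) (pRange q₀) ∧
      ∀ {Ω : Type*} [MeasurableSpace Ω] (P : Measure Ω) [IsProbabilityMeasure P]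
        (X : Ω → Fin K → ℝ), HasLaw X (law q₁) P →
      HasLaw (fun ω => phi q₀ (X ω))
        ((volume.restrict (pRange q₀)).withDensity
          fun u => (likelihoodRatio q₀ q₁ u : ℝ≥0∞)) P) := by
  have h := RegularDensity.of_marginals hq₀ h_fin h_cont
  have hφ := measurable_phi h.measurable
  refine ⟨⟨h.mapsTo_phi, h.continuousOn_phi, h.injOn_phi⟩, fun P _ X hX => ?_,
    ⟨h.isOpen_pRange, h.volume_Icc_diff_pRange⟩, h.continuousOn_likelihoodRatio hq₁_cont,
    fun P _ X hX => ?_⟩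
  · exact iIndepFun_and_hasLaw_of_map_eq (hφ.comp_aemeasurable hX.aemeasurable)
      ((map_phi_comp h.measurable hX).trans h.map_phi)
  · exact ⟨hφ.comp_aemeasurable hX.aemeasurable,
      (map_phi_comp h.measurable hX).trans (h.map_phi_law h_sppt hq₁_cont)⟩
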